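/- Let $K$ be a field of characteristic zero that is either a number field or the function field of a curve over a field $k$ (that is, a finite extension of $k(t)$ with $t$ transcendental over $k$). Let $d\ge 2$, let $c_1,\dots,c_s\in K$, and put $S=\{x^d+c_1,\dots,x^d+c_s\}$. Assume that $K$ contains a primitive $d$-th root of unity. Let $\theta_1,\theta_2,\dots$ be a sequence of elements of $S$, let $\gamma_m=\theta_1\circ\cdots\circ\theta_m$ for $m\ge1$, and let $K(\gamma_m)$ denote the splitting field of $\gamma_m$ over $K$ inside a fixed algebraic closure of $K$. Suppose that $n\ge 2$, that $\gamma_n$ is irreducible over $K$, and that there is a prime $\mathfrak p$ of $K$ (a nonzero prime ideal of the ring of integers $\mathcal O_K$ if $K$ is a number field; a nontrivial place of $K$ that is trivial on $k$ if $K$ is a function field) with normalized additive valuation $v_{\mathfrak p}:K^\times\to\mathbb Z$, extended by $v_{\mathfrak p}(0)=\infty$, such that 1. $v_{\mathfrak p}(d)=0$; 2. $v_{\mathfrak p}(c_i)\ge 0$ for all $1\le i\le s$; 3. $0<v_{\mathfrak p}(\gamma_n(0))<\infty$ and $\gcd(v_{\mathfrak p}(\gamma_n(0)),d)=1$; 4.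 $v_{\mathfrak p}(\gamma_m(0))=0$ for all $1\le m\le n-1$. Then $K(\gamma_{n-1})\subseteq K(\gamma_n)$ and the extension $K(\gamma_n)/K(\gamma_{n-1})$ is maximal, i.e. $[K(\gamma_n):K(\gamma_{n-1})]=d^{\,d^{n-1}}$. -/

import Mathlib

open Polynomial IsDedekindDomain
open scoped NumberField WithZero

/-- `v` is the (multiplicatively written) normalized `𝔭`-adic valuation of the number field `K`
for some nonzero prime ideal `𝔭` of its ring of integers. -/
def IsNumberFieldPrime (K : Type*) [Field K] (v : Valuation K ℤᵐ⁰) : Prop :=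
  ∃ (_ : NumberField K) (𝔭 : HeightOneSpectrum (𝓞 K)), v = 𝔭.valuation K

/-- `K` is the function field of a curve over a base field `k ⊆ K`, that is, a finite extension
of a rational function field `k(t)`, and `v` is the normalized valuation of a (nontrivial) place
of `K` that is trivial on `k`. -/
def IsFunctionFieldPrime (K : Type*) [Field K] (v : Valuation K ℤᵐ⁰) : Prop :=
  ∃ (k : Subfield K) (_ : Algebra (RatFunc k) K) (_ : IsScalarTower k (RatFunc k) K),
    FunctionField k K ∧ Function.Surjective v ∧ ∀ a ∈ k, a ≠ 0 → v a = 1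

/-- The set `S = {x ^ d + c₁, …, x ^ d + cₛ}`. -/
def unicriticalSet {K : Type*} [Field K] (d : ℕ) {s : ℕ} (c : Fin s → K) : Set K[X] :=
  Set.range fun i => X ^ d + C (c i)

/-- `γₙ = θ₁ ∘ ⋯ ∘ θₙ`, where the sequence `θ₁, θ₂, …` is indexed from `0`, so that `θ i` stands
for `θᵢ₊₁`; `γ₀ = x`. -/
noncomputable def seqComp {K : Type*} [Field K] (θ : ℕ → K[X]) : ℕ → K[X]
  | 0 => X
  | n + 1 => (seqComp θ n).comp (θ n)

/-- The splitting field `K(f)` of `f` inside the algebraic closure of `K`. -/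
noncomputable def splittingFieldIn {K : Type*} [Field K] (f : K[X]) :
    IntermediateField K (AlgebraicClosure K) :=
  IntermediateField.adjoin K (f.rootSet (AlgebraicClosure K))

/-- The prime with normalized valuation `v` is a good primitive prime divisor of `γₙ(0)`.
Since `v` is written multiplicatively, `v x ≤ 1`, `v x = 1` and `v x = exp (-e)` say that `x` has
additive valuation `≥ 0`, `= 0` and `= e`, respectively. -/
structure IsGoodPrimitivePrimeDivisor {K : Type*} [Field K] (v : Valuation K ℤᵐ⁰)
    (d : ℕ) {s : ℕ} (c : Fin s → K) (θ : ℕ → K[X]) (n : ℕ) : Prop where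
  val_degree : v (d : K) = 1
  val_coeff : ∀ i, v (c i) ≤ 1
  val_top : ∃ e : ℕ, 0 < e ∧ e.Coprime d ∧ v ((seqComp θ n).eval 0) = WithZero.exp (-(e : ℤ))
  val_lower : ∀ m, 1 ≤ m → m ≤ n - 1 → v ((seqComp θ m).eval 0) = 1

/-!
Write `f = γₙ₋₁`, `N = d ^ (n - 1)`, `L = K(f)` and `θₙ = x ^ d + a`. The polynomial `f` is
irreducible because `γₙ = f ∘ θₙ` is, so it has `N` distinct roots `β`. As `K` contains the `d`-th
roots of unity, `K(γₙ)` arises from `L` by adjoining one root `δ β` of `x ^ d = β - a` for each `β`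
(`splittingFieldIn_seqComp_succ`). It remains to see that each of these `N` steps, in any order, has
degree `d`. Ramification shows this without Kummer theory.

Extend `v` to a valuation `w` of the algebraic closure. By the chain rule and the condition on the
`γₘ(0)`, `m < n`, the derivative of `f` is a `w`-unit at every root of `f`
(`derivative_eval_root_seqComp`). This has two consequences.

* `L` is unramified over `K` at `w`: the values of `w` on `L` are powers of the value `ϖ` of a
  uniformizer of `K` (`Valuation.valuesInZPowers_adjoin_rootSet`). The reason is that adjoining a root
  that is simple modulo the maximal ideal creates no new values
  (`Valuation.zpow_of_mem_adjoin_simple`).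
* The roots of `f` are pairwise incongruent, so exactly one root `β₀` is congruent to `a`, and
  `w (β₀ - a) = w (γₙ(0)) = ϖ ^ k` with `k` prime to `d`, because `γₙ(0) = f(a) = ∏ (a - β)`
  (`Valuation.exists_root_sub_eq`).

The Galois group is transitive on the roots of `f`, so composing `w` with automorphisms gives for
each `β` an extension `w_β` of `v` for which `β` plays the role of `β₀`. Then `w_β` is unramified in
`L` and in every extension by a `δ β'` with `β' ≠ β`, since `β' - a` is a `w_β`-unit, as is `d`,
whereas `w_β (δ β) ^ d = ϖ ^ k` forces `δ β` to have degree `d`. So each step has degree `d`,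
whatever the order of the roots (`relfinrank_sup_adjoin_image_eq_pow`).
-/

/-! ### Unramified extensions by a root that is simple modulo the maximal ideal -/

/-- If `b` is a simple root of `f` modulo the maximal ideal, then that ideal is locally
generated by the maximal ideal of `O`: for every non-unit `g(b)` there is a unit `q(b)` such
that `q(b) g(b)` is a polynomial in `b` with coefficients in the maximal ideal of `O`. Here `q` lifts
the cofactor in the reduction of `f` of the minimal polynomial of the residue of `b`. -/
theorem exists_isUnit_eval₂_mul_sub_mem {O R : Type*} [CommRing O] [IsLocalRing O] [CommRing R]
    [IsLocalRing R] (i : O →+* R) [IsLocalHom i] {f : O[X]} {b : R}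
    (hf : f.eval₂ i b = 0) (hf' : IsUnit (f.derivative.eval₂ i b))
    {g : O[X]} (hg : ¬ IsUnit (g.eval₂ i b)) :
    ∃ q t : O[X], IsUnit (q.eval₂ i b) ∧
      ∀ n, (q * g - f * t).coeff n ∈ IsLocalRing.maximalIdeal O := by
  let κ := IsLocalRing.ResidueField O
  let res : O →+* κ := IsLocalRing.residue O
  let ψ : κ →+* IsLocalRing.ResidueField R := IsLocalRing.ResidueField.map i
  let b' := IsLocalRing.residue R b
  have hev (p : O[X]) : IsLocalRing.residue R (p.eval₂ i b) = (p.map res).eval₂ ψ b' := by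
    rw [hom_eval₂, eval₂_map]
    rfl
  have hunit (p : O[X]) : IsUnit (p.eval₂ i b) ↔ (p.map res).eval₂ ψ b' ≠ 0 := by
    rw [← hev, IsLocalRing.residue_ne_zero_iff_isUnit]
  -- the polynomials over the residue field that vanish at `b'` form a principal ideal `(h)`
  let I : Ideal κ[X] := RingHom.ker (eval₂RingHom ψ b')
  obtain ⟨h, hh⟩ := (IsPrincipalIdealRing.principal I).principal
  have hmem (p : κ[X]) : h ∣ p ↔ p.eval₂ ψ b' = 0 := by
    rw [← Ideal.mem_span_singleton, ← Ideal.submodule_span_eq, ← hh]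
    rfl
  obtain ⟨q, hq⟩ := (hmem (f.map res)).2 (by rw [← hev, hf, map_zero])
  obtain ⟨t, ht⟩ := (hmem (g.map res)).2 (by simpa using (hunit g).not.1 hg)
  obtain ⟨q, rfl⟩ := map_surjective res IsLocalRing.residue_surjective q
  obtain ⟨t, rfl⟩ := map_surjective res IsLocalRing.residue_surjective t
  refine ⟨q, t, (hunit q).2 fun h0 => (hunit _).1 hf' ?_, fun n => ?_⟩
  · rw [← derivative_map, hq, derivative_mul, eval₂_add, eval₂_mul, eval₂_mul, h0,
      (hmem h).1 dvd_rfl, mul_zero, zero_mul, add_zero]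
  · rw [← IsLocalRing.residue_eq_zero_iff]
    change res _ = 0
    rw [← coeff_map, Polynomial.map_sub, Polynomial.map_mul, Polynomial.map_mul, hq, ht]
    rw [show q.map res * (h * t.map res) - h * q.map res * t.map res = 0 by ring, coeff_zero]

theorem exists_eval₂_eq_unit_mul {O R : Type*} [CommRing O] [IsLocalRing O] [CommRing R]
    [IsLocalRing R] (i : O →+* R) [IsLocalHom i] {π : O}
    (hπ : ∀ x ∈ IsLocalRing.maximalIdeal O, π ∣ x) {f : O[X]} {b : R}
    (hf : f.eval₂ i b = 0) (hf' : IsUnit (f.derivative.eval₂ i b))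
    {g : O[X]} (hg : ¬ IsUnit (g.eval₂ i b)) :
    ∃ (u : Rˣ) (g₁ : O[X]), g.eval₂ i b = u * i π * g₁.eval₂ i b := by
  obtain ⟨q, t, ⟨u, hu⟩, hqt⟩ := exists_isUnit_eval₂_mul_sub_mem i hf hf' hg
  obtain ⟨g₁, h₁⟩ := C_dvd_iff_dvd_coeff π (q * g - f * t) |>.2 fun n => hπ _ (hqt n)
  have h2 := congrArg (eval₂ i b) h₁
  rw [eval₂_sub, eval₂_mul, eval₂_mul, eval₂_mul, hf, eval₂_C, zero_mul, sub_zero, ← hu] at h2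
  exact ⟨u⁻¹, g₁, by rw [mul_assoc, ← h2, Units.inv_mul_cancel_left]⟩

/-- If `F` has uniformizer `π` and `β` is a root of a monic integral `f`, simple modulo the maximal
ideal of `w`, then every nonzero element of `F(β)` has a power of `w π` as value. -/
theorem Valuation.zpow_of_mem_adjoin_simple {F E Γ : Type*} [Field F] [Field E] [Algebra F E]
    [LinearOrderedCommGroupWithZero Γ] (w : Valuation E Γ) {π : F}
    (hπ0 : π ≠ 0) (hπ1 : w (algebraMap F E π) < 1)
    (hF : ∀ x : F, x ≠ 0 → ∃ k : ℤ, w (algebraMap F E x) = w (algebraMap F E π) ^ k)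
    {f : F[X]} (hfm : f.Monic) (hfi : ∀ n, w (algebraMap F E (f.coeff n)) ≤ 1) {β : E}
    (hβ : aeval β f = 0) (hβ' : w (aeval β f.derivative) = 1) {x : E}
    (hx : x ∈ IntermediateField.adjoin F {β}) (hx0 : x ≠ 0) :
    ∃ k : ℤ, w x = w (algebraMap F E π) ^ k := by
  set ϖ := w (algebraMap F E π) with hϖ
  have hϖ0 : ϖ ≠ 0 := by simpa [hϖ] using hπ0
  let O := (w.comap (algebraMap F E)).valuationSubring
  let R := w.valuationSubring
  have memO (y : F) : y ∈ O ↔ w (algebraMap F E y) ≤ 1 := Iff.rfl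
  have unitO (y : O) : IsUnit y ↔ w (algebraMap F E y) = 1 :=
    Valuation.Integers.isUnit_iff_valuation_eq_one
      (Valuation.integer.integers (w.comap (algebraMap F E)))
  have unitR (y : R) : IsUnit y ↔ w (y : E) = 1 :=
    Valuation.Integers.isUnit_iff_valuation_eq_one (Valuation.integer.integers w)
  let i : O →+* R := ((algebraMap F E).comp O.subtype).codRestrict R fun y => y.2
  have hi (y : O) : (i y : E) = algebraMap F E y := rfl
  have : IsLocalHom i := ⟨fun y hy => by rwa [unitR, hi, ← unitO] at hy⟩
  -- `π` generates the maximal ideal of `O`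
  have hmax : ∀ y ∈ IsLocalRing.maximalIdeal O, (⟨π, (memO π).2 hπ1.le⟩ : O) ∣ y := by
    intro y hy
    by_cases hy0 : y = 0
    · simp [hy0]
    have hy1 : w (algebraMap F E y) < 1 := lt_of_le_of_ne y.2 fun h => hy ((unitO y).2 h)
    have hle : w (algebraMap F E y) ≤ ϖ := by
      obtain ⟨k, hk⟩ := hF y (by simpa using hy0)
      rw [hk] at hy1 ⊢
      have hk0 : 0 < k := by
        by_contra! h
        exact hy1.not_ge (one_le_zpow_of_nonpos₀ (zero_lt_iff.2 hϖ0) hπ1.le h)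
      simpa using zpow_le_zpow_right_of_le_one₀ (zero_lt_iff.2 hϖ0) hπ1.le
        (show (1 : ℤ) ≤ k by lia)
    refine ⟨⟨y / π, (memO _).2 ?_⟩, Subtype.ext ?_⟩
    · rw [map_div₀, map_div₀]
      exact div_le_one_of_le₀ hle zero_le
    · simp [mul_div_cancel₀ _ hπ0]
  obtain ⟨f, rfl⟩ : ∃ f₀ : O[X], f₀.map O.subtype = f :=
    (mem_lifts f).1 ((lifts_iff_coeff_lifts f).2 fun n => ⟨⟨_, hfi n⟩, rfl⟩)
  have hβR : β ∈ R := by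
    have : IsIntegral R β := by
      refine ⟨f.map i, Monic.map _ (monic_of_injective (Subtype.val_injective) hfm), ?_⟩
      rw [eval₂_map]
      rwa [aeval_def, eval₂_map] at hβ
    obtain ⟨y, hy⟩ := IsIntegrallyClosed.isIntegral_iff.1 this
    exact hy ▸ y.2
  have hev (g : O[X]) : ((g.eval₂ i ⟨β, hβR⟩ : R) : E) = aeval β (g.map O.subtype) := by
    rw [aeval_def, eval₂_map, ← R.subtype_apply, hom_eval₂]
    rfl
  -- descent: a non-unit `g(β)` is a unit times `π g₁(β)`, and a lower bound on the value of `g(β)`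
  -- makes the process stop
  have hdesc (N : ℕ) : ∀ g : O[X], ϖ ^ N ≤ w (g.eval₂ i ⟨β, hβR⟩ : R) →
      ∃ k : ℕ, w (g.eval₂ i ⟨β, hβR⟩ : R) = ϖ ^ k := by
    induction N with
    | zero => exact fun g hg => ⟨0, le_antisymm ((eval₂ i _ g).2.trans_eq (pow_zero ϖ).symm) hg⟩
    | succ N ih =>
      intro g hg
      by_cases hu : IsUnit (g.eval₂ i ⟨β, hβR⟩)
      · exact ⟨0, by simpa using (unitR _).1 hu⟩
      obtain ⟨u, g₁, h₁⟩ := exists_eval₂_eq_unit_mul i hmax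
        (f := f) (b := ⟨β, hβR⟩) (Subtype.ext (by rw [hev, hβ]; rfl))
        ((unitR _).2 (by rw [hev, ← derivative_map, hβ'])) hu
      have h2 : w (g.eval₂ i ⟨β, hβR⟩ : R) = ϖ * w (g₁.eval₂ i ⟨β, hβR⟩ : R) := by
        rw [h₁]
        simp [(unitR _).1 u.isUnit, hi, hϖ]
      rw [h2, pow_succ', mul_le_mul_iff_right₀ (zero_lt_iff.2 hϖ0)] at hg
      obtain ⟨k, hk⟩ := ih g₁ hg
      exact ⟨k + 1, by rw [h2, hk, pow_succ']⟩
  -- every element of `F(β)` is an `O`-polynomial in `β` divided by an element of `O`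
  have hfrac : ∀ y ∈ IntermediateField.adjoin F {β}, ∃ (g : O[X]) (a : O), a ≠ 0 ∧
      algebraMap F E a * y = (g.eval₂ i ⟨β, hβR⟩ : R) := by
    intro y hy
    have halg : IsAlgebraic F β := ⟨_, hfm.ne_zero, hβ⟩
    rw [← IntermediateField.mem_toSubalgebra,
      IntermediateField.adjoin_simple_toSubalgebra_of_isAlgebraic halg,
      Algebra.adjoin_singleton_eq_range_aeval] at hy
    obtain ⟨p, rfl⟩ := hy
    obtain ⟨b, hb0, hb⟩ := IsLocalization.integerNormalization_spec (nonZeroDivisors O) p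
    refine ⟨IsLocalization.integerNormalization (nonZeroDivisors O) p, b,
      nonZeroDivisors.ne_zero hb0, ?_⟩
    have hb' : (IsLocalization.integerNormalization (nonZeroDivisors O) p).map O.subtype =
        C (b : F) * p := by
      rw [← smul_eq_C_mul]
      exact hb
    rw [hev, hb', map_mul, aeval_C]
    rfl
  have hmain : ∀ y ∈ IntermediateField.adjoin F {β}, y ≠ 0 → ∀ (g : O[X]),
      y = (g.eval₂ i ⟨β, hβR⟩ : R) → ∃ k : ℕ, w (g.eval₂ i ⟨β, hβR⟩ : R) = ϖ ^ k := by
    intro y hy hy0 g hg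
    -- an integral multiple `a y⁻¹` of the inverse bounds the value of `y` from below by that of `a`
    obtain ⟨g₁, a, ha, h₁⟩ := hfrac y⁻¹ (inv_mem hy)
    have ha0 : (a : F) ≠ 0 := by simpa using ha
    obtain ⟨k, hk⟩ := hF a ha0
    refine hdesc k.toNat g ?_
    rw [← hg]
    have h3 : w (algebraMap F E a) ≤ w y := by
      have h4 : w (algebraMap F E a * y⁻¹) ≤ 1 := h₁ ▸ Subtype.prop (eval₂ i _ g₁)
      rw [map_mul, map_inv₀] at h4
      exact (mul_inv_le_iff₀ (zero_lt_iff.2 (by simpa using hy0))).1 h4 |>.trans_eq (one_mul _)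
    refine le_trans ?_ h3
    rw [hk, ← zpow_natCast]
    exact zpow_le_zpow_right_of_le_one₀ (zero_lt_iff.2 hϖ0) hπ1.le (Int.self_le_toNat k)
  obtain ⟨g, a, ha, h₁⟩ := hfrac x hx
  have ha0 : algebraMap F E a ≠ 0 := by simpa using ha
  obtain ⟨k, hk⟩ := hF a (by simpa using ha)
  obtain ⟨l, hl⟩ := hmain _ (mul_mem (IntermediateField.algebraMap_mem _ _) hx)
    (mul_ne_zero ha0 hx0) g h₁
  refine ⟨l - k, ?_⟩
  rw [zpow_sub₀ hϖ0, ← hk, zpow_natCast, ← hl, ← h₁, map_mul, mul_div_cancel_left₀]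
  simpa using ha

/-! ### Extension of a valuation, uniformizers -/

theorem Valuation.exists_isEquiv_comap_algebraMap {K E Γ : Type*} [Field K] [Field E]
    [Algebra K E] [LinearOrderedCommGroupWithZero Γ] (v : Valuation K Γ) :
    ∃ B : ValuationSubring E, v.IsEquiv (B.valuation.comap (algebraMap K E)) := by
  let A := v.valuationSubring
  let φ := (algebraMap K E).comp A.subtype
  let A' : LocalSubring E := LocalSubring.range φ
  obtain ⟨B, hAB, hloc⟩ := A'.exists_le_valuationSubring
  have hle {x : K} (hx : v x ≤ 1) : algebraMap K E x ∈ B := hAB ⟨⟨x, hx⟩, rfl⟩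
  refine ⟨B, Valuation.isEquiv_of_val_le_one fun x => ?_⟩
  rw [Valuation.comap_apply, B.valuation_le_one_iff]
  refine ⟨hle, fun hx => ?_⟩
  by_contra! hx1
  have hx0 : x ≠ 0 := by rintro rfl; simp at hx1
  -- `x⁻¹` would be a unit of `B` but not of the valuation ring of `v`
  have hxi : v x⁻¹ < 1 := by simpa using inv_lt_one_of_one_lt₀ hx1
  let y : A'.toSubring := ⟨algebraMap K E x⁻¹, ⟨⟨x⁻¹, hxi.le⟩, rfl⟩⟩
  have hu : IsUnit y := hloc.map_nonunit y (isUnit_iff_exists_inv.2 ⟨⟨algebraMap K E x, hx⟩,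
    Subtype.ext (by simp [y, Subring.inclusion, hx0])⟩)
  obtain ⟨⟨_, ⟨z, rfl⟩⟩, hz⟩ := isUnit_iff_exists_inv.1 hu
  have hz' : algebraMap K E (x⁻¹ * z) = algebraMap K E 1 := by
    rw [map_mul, map_one]
    exact congrArg Subtype.val hz
  have := congrArg v ((algebraMap K E).injective hz')
  rw [map_mul, map_one] at this
  exact (mul_lt_one_of_nonneg_of_lt_one_left zero_le hxi z.2).ne this

theorem Valuation.exists_generator {K : Type*} [Field K] {v : Valuation K ℤᵐ⁰} {x : K} {e : ℕ}
    (he : 0 < e) (hx : v x = WithZero.exp (-(e : ℤ))) :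
    ∃ (π : K) (g : ℕ), 0 < g ∧ v π = WithZero.exp (-(g : ℤ)) ∧
      ∀ y : K, y ≠ 0 → ∃ k : ℤ, v y = v π ^ k := by
  classical
  have hex : ∃ g : ℕ, 0 < g ∧ ∃ π : K, v π = WithZero.exp (-(g : ℤ)) := ⟨e, he, x, hx⟩
  obtain ⟨hg, π, hπ⟩ := Nat.find_spec hex
  set g := Nat.find hex with hgdef
  refine ⟨π, g, hg, hπ, fun y hy => ?_⟩
  obtain ⟨a, ha⟩ : ∃ a : ℤ, v y = WithZero.exp a :=
    ⟨WithZero.log (v y), (WithZero.exp_log (v.ne_zero_iff.2 hy)).symm⟩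
  -- by minimality of `g`, the remainder of `a` modulo `g` vanishes
  have hr : (-a) % g = 0 := by
    by_contra hr
    have h0 := Int.emod_nonneg (-a) (b := g) (by lia)
    have h1 := Int.emod_lt_of_pos (-a) (b := g) (by lia)
    refine Nat.find_min hex (m := ((-a) % g).toNat) (by lia) ⟨by lia, y / π ^ ((-a) / g), ?_⟩
    rw [map_div₀, map_zpow₀, ha, hπ, ← WithZero.exp_zsmul, ← WithZero.exp_sub]
    congr 1
    have h2 := Int.emod_add_mul_ediv (-a) g
    rw [Int.toNat_of_nonneg h0, smul_eq_mul]
    linear_combination h2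
  refine ⟨(-a) / g, ?_⟩
  rw [ha, hπ, ← WithZero.exp_zsmul]
  congr 1
  have h2 := Int.emod_add_mul_ediv (-a) g
  rw [smul_eq_mul]
  linear_combination h2 - hr

/-! ### Ramification in towers of intermediate fields -/

section Tower

variable {K E Γ : Type*} [Field K] [Field E] [Algebra K E] [LinearOrderedCommGroupWithZero Γ]

/-- The valuation `w` takes only powers of `ϖ` as values on `F ∖ {0}`. When `ϖ` is the value of a
uniformizer of the ground field, this says that the ramification index of `F` at `w` over the
ground field is one. -/
def Valuation.ValuesInZPowers (w : Valuation E Γ) (ϖ : Γ) (F : IntermediateField K E) : Prop :=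
  ∀ x ∈ F, x ≠ 0 → ∃ k : ℤ, w x = ϖ ^ k

/-- `β` is a root of a monic polynomial with `w`-integral coefficients in `F`, and it is a simple
root modulo the maximal ideal of `w`. -/
def Valuation.IsResidueSimpleRoot (w : Valuation E Γ) (F : IntermediateField K E) (β : E) : Prop :=
  ∃ f : E[X], f.Monic ∧ (∀ n, f.coeff n ∈ F ∧ w (f.coeff n) ≤ 1) ∧ f.eval β = 0 ∧
    w (f.derivative.eval β) = 1

theorem Valuation.IsResidueSimpleRoot.mono {w : Valuation E Γ} {F F' : IntermediateField K E}
    {β : E} (h : w.IsResidueSimpleRoot F β) (hF : F ≤ F') : w.IsResidueSimpleRoot F' β := by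
  obtain ⟨f, hm, hc, h0, h1⟩ := h
  exact ⟨f, hm, fun n => ⟨hF (hc n).1, (hc n).2⟩, h0, h1⟩

/-- Adjoining a root that is simple modulo the maximal ideal is an unramified extension. -/
theorem Valuation.ValuesInZPowers.sup_adjoin_simple {w : Valuation E Γ} {π : K}
    (hπ0 : π ≠ 0) (hπ1 : w (algebraMap K E π) < 1) {F : IntermediateField K E}
    (hF : w.ValuesInZPowers (w (algebraMap K E π)) F) {β : E} (hβ : w.IsResidueSimpleRoot F β) :
    w.ValuesInZPowers (w (algebraMap K E π)) (F ⊔ IntermediateField.adjoin K {β}) := by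
  intro x hx hx0
  obtain ⟨f, hfm, hfc, h0, h1⟩ := hβ
  obtain ⟨f, rfl⟩ : ∃ f₀ : F[X], f₀.map (algebraMap F E) = f :=
    (mem_lifts f).1 ((lifts_iff_coeff_lifts f).2 fun n => ⟨⟨_, (hfc n).1⟩, rfl⟩)
  rw [← IntermediateField.restrictScalars_adjoin_eq_sup,
    IntermediateField.mem_restrictScalars] at hx
  refine w.zpow_of_mem_adjoin_simple (F := F) (π := algebraMap K F π) (f := f) (β := β)
    (by simpa using hπ0) hπ1 (fun y hy => hF y y.2 (by simpa using hy))
    (monic_of_injective (algebraMap F E).injective hfm) (fun n => ?_) ?_ ?_ hx hx0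
  · simpa using (hfc n).2
  · rwa [← eval_map_algebraMap]
  · rwa [← eval_map_algebraMap, ← derivative_map]

theorem Valuation.ValuesInZPowers.sup_adjoin {w : Valuation E Γ} {π : K}
    (hπ0 : π ≠ 0) (hπ1 : w (algebraMap K E π) < 1) {F : IntermediateField K E}
    (hF : w.ValuesInZPowers (w (algebraMap K E π)) F) (S : Finset E)
    (hS : ∀ β ∈ S, w.IsResidueSimpleRoot F β) :
    w.ValuesInZPowers (w (algebraMap K E π)) (F ⊔ IntermediateField.adjoin K (S : Set E)) := by
  classical
  induction S using Finset.induction_on with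
  | empty => simpa using hF
  | insert β S _ ih =>
    have h := (ih fun γ hγ => hS γ (Finset.mem_insert_of_mem hγ)).sup_adjoin_simple hπ0 hπ1
      ((hS β (Finset.mem_insert_self β S)).mono le_sup_left)
    rwa [Finset.coe_insert, Set.insert_eq, Set.union_comm, IntermediateField.adjoin_union,
      ← sup_assoc]

theorem Valuation.valuesInZPowers_adjoin_rootSet {w : Valuation E Γ} {π : K}
    (hπ0 : π ≠ 0) (hπ1 : w (algebraMap K E π) < 1)
    (hK : ∀ x : K, x ≠ 0 → ∃ k : ℤ, w (algebraMap K E x) = w (algebraMap K E π) ^ k)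
    {f : K[X]} (hm : f.Monic) (hf : ∀ n, w (algebraMap K E (f.coeff n)) ≤ 1)
    (hder : ∀ x : E, aeval x f = 0 → w (aeval x f.derivative) = 1) :
    w.ValuesInZPowers (w (algebraMap K E π)) (IntermediateField.adjoin K (f.rootSet E)) := by
  have hbot : w.ValuesInZPowers (w (algebraMap K E π)) (⊥ : IntermediateField K E) := by
    intro x hx hx0
    obtain ⟨y, rfl⟩ := IntermediateField.mem_bot.1 hx
    exact hK y fun h => hx0 (by rw [h, map_zero])
  have h := hbot.sup_adjoin hπ0 hπ1 (f.rootSet E).toFinset fun x hx => ?_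
  · rwa [bot_sup_eq, Set.coe_toFinset] at h
  · have hx := (mem_rootSet.1 (Set.mem_toFinset.1 hx)).2
    refine ⟨f.map (algebraMap K E), hm.map _, fun n => ?_, ?_, ?_⟩
    · rw [coeff_map]
      exact ⟨IntermediateField.algebraMap_mem _ _, hf n⟩
    · rwa [eval_map_algebraMap]
    · rw [derivative_map, eval_map_algebraMap]
      exact hder x hx

/-- Total ramification: the degree of `δ` over `F` is a multiple of `d`, because the norm of `δ`
has value `ϖ ^ (k * deg δ / d)`, which must be an integral power of `ϖ`. -/
theorem Valuation.ValuesInZPowers.relfinrank_sup_adjoin_simple [IsAlgClosed E]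
    {w : Valuation E Γ} {ϖ : Γ} (hϖ0 : ϖ ≠ 0) (hϖ1 : ϖ < 1) {F : IntermediateField K E}
    (hF : w.ValuesInZPowers ϖ F) {d : ℕ} (hd : 0 < d) {δ : E} (hδ : δ ^ d ∈ F) {k : ℤ}
    (hk : w (δ ^ d) = ϖ ^ k) (hkd : IsCoprime k d) :
    IntermediateField.relfinrank F (F ⊔ IntermediateField.adjoin K {δ}) = d := by
  have hδ0 : δ ≠ 0 := by
    rintro rfl
    rw [zero_pow hd.ne', map_zero] at hk
    exact zpow_ne_zero k hϖ0 hk.symm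
  have hX : aeval δ (X ^ d - C (⟨δ ^ d, hδ⟩ : F)) = 0 := by
    simp [aeval_C, IntermediateField.algebraMap_apply]
  have hXm : (X ^ d - C (⟨δ ^ d, hδ⟩ : F)).Monic := monic_X_pow_sub_C _ hd.ne'
  have hint : IsIntegral F δ := ⟨_, hXm, hX⟩
  rw [← IntermediateField.restrictScalars_adjoin_eq_sup,
    IntermediateField.relfinrank_eq_finrank_of_le
      (by rw [IntermediateField.restrictScalars_adjoin_eq_sup]; exact le_sup_left)]
  change Module.finrank F (IntermediateField.adjoin F {δ}) = d
  rw [IntermediateField.adjoin.finrank hint]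
  set p := minpoly F δ
  have hdvd : p ∣ X ^ d - C (⟨δ ^ d, hδ⟩ : F) := minpoly.dvd _ _ hX
  have hle : p.natDegree ≤ d :=
    (natDegree_le_of_dvd hdvd hXm.ne_zero).trans_eq (natDegree_X_pow_sub_C)
  refine le_antisymm hle (Nat.le_of_dvd (minpoly.natDegree_pos hint) ?_)
  -- all conjugates of `δ` have the value of `δ`, so the norm of `δ` has value `w δ ^ deg p`
  have hroots : ∀ r ∈ (p.map (algebraMap F E)).roots, w r = w δ := by
    intro r hr
    have h1 : aeval r p = 0 := by
      rw [← eval_map_algebraMap]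
      exact (mem_roots'.1 hr).2
    have h2 := aeval_eq_zero_of_dvd_aeval_eq_zero hdvd h1
    have h3 : r ^ d = δ ^ d := by
      simpa [sub_eq_zero, aeval_C, IntermediateField.algebraMap_apply] using h2
    exact (pow_left_inj₀ zero_le zero_le hd.ne').1 (by rw [← map_pow, h3, map_pow])
  have hsplit := IsAlgClosed.splits (p.map (algebraMap F E))
  have hnorm : w (algebraMap F E (p.coeff 0)) = w δ ^ p.natDegree := by
    rw [← coeff_map, hsplit.coeff_zero_eq_prod_roots_of_monic ((minpoly.monic hint).map _),
      map_mul, map_pow, Valuation.map_neg, map_one, one_pow, one_mul, map_multiset_prod,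
      Multiset.map_congr rfl hroots, Multiset.map_const', Multiset.prod_replicate,
      ← hsplit.natDegree_eq_card_roots, natDegree_map]
  have hp0 : algebraMap F E (p.coeff 0) ≠ 0 := by
    rw [← w.ne_zero_iff, hnorm]
    exact pow_ne_zero _ (w.ne_zero_iff.2 hδ0)
  obtain ⟨l, hl⟩ := hF _ (p.coeff 0).2 hp0
  have hl' : ϖ ^ (l * d) = ϖ ^ (k * p.natDegree) := by
    rw [zpow_mul, zpow_mul, ← hk, ← hl, map_pow, zpow_natCast, zpow_natCast, ← pow_mul, mul_comm d,
      pow_mul, ← hnorm]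
    rfl
  have h4 : l * d = k * p.natDegree :=
    (zpow_right_strictAnti₀ (zero_lt_iff.2 hϖ0) hϖ1).injective hl'
  exact Int.natCast_dvd_natCast.1 (hkd.symm.dvd_of_dvd_mul_left ⟨l, by rw [← h4, mul_comm]⟩)

/-- A valuative substitute for Kummer theory. Let every `δ β ^ d` lie in `F`, and suppose that each
`β ∈ T` has a valuation that ramifies in `F(δ β)` but in none of the other `F(δ β')`. Adjoining the
`δ β` one after another, every step has degree `d`: the valuation of `β` is still unramified
when `δ β` is to be adjoined. -/
theorem relfinrank_sup_adjoin_image_eq_pow [IsAlgClosed E] {ϖ : Γ} {π : K} (hπ0 : π ≠ 0)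
    (hϖ1 : ϖ < 1) {d : ℕ} (hd : 0 < d) {F : IntermediateField K E} (T : Finset E) (δ : E → E)
    (hδF : ∀ β ∈ T, δ β ^ d ∈ F) (w : E → Valuation E Γ)
    (hwπ : ∀ β ∈ T, w β (algebraMap K E π) = ϖ)
    (hwd : ∀ β ∈ T, w β d = 1) (hwF : ∀ β ∈ T, (w β).ValuesInZPowers ϖ F)
    {k : ℤ} (hkd : IsCoprime k d) (hself : ∀ β ∈ T, w β (δ β ^ d) = ϖ ^ k)
    (hne : ∀ β ∈ T, ∀ β' ∈ T, β' ≠ β → w β (δ β' ^ d) = 1) :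
    IntermediateField.relfinrank F (F ⊔ IntermediateField.adjoin K (δ '' (T : Set E))) =
      d ^ T.card := by
  classical
  induction T using Finset.induction_on with
  | empty => simp [IntermediateField.relfinrank_self]
  | insert β T hβT ih =>
    have hsub {γ : E} (h : γ ∈ T) : γ ∈ insert β T := Finset.mem_insert_of_mem h
    have hβ := Finset.mem_insert_self β T
    have hϖ := hwπ β hβ
    have hϖ0 : ϖ ≠ 0 := by
      rw [← hϖ]
      simpa using hπ0
    have hsimple : ∀ x ∈ T.image δ, (w β).IsResidueSimpleRoot F x := by
      intro x hx
      obtain ⟨γ, hγ, rfl⟩ := Finset.mem_image.1 hx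
      have h1 := hne β hβ γ (hsub hγ) fun h => hβT (h ▸ hγ)
      have h2 : w β (δ γ) = 1 := (pow_left_inj₀ zero_le zero_le hd.ne').1
        (by rw [← map_pow, h1, one_pow])
      refine ⟨X ^ d - C (δ γ ^ d), monic_X_pow_sub_C _ hd.ne', fun n => ?_, by simp, ?_⟩
      · rw [coeff_sub, coeff_X_pow, coeff_C]
        refine ⟨sub_mem ?_ ?_, (w β).map_sub_le ?_ ?_⟩ <;> split_ifs <;> simp [h2, hδF γ (hsub hγ)]
      · rw [derivative_sub, derivative_C, sub_zero, derivative_X_pow]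
        simp [hwd β hβ, h2]
    have hval : (w β).ValuesInZPowers ϖ (F ⊔ IntermediateField.adjoin K (δ '' (T : Set E))) := by
      have := Valuation.ValuesInZPowers.sup_adjoin hπ0 (by rwa [hϖ]) (by rw [hϖ]; exact hwF β hβ)
        (T.image δ) hsimple
      rwa [hϖ, Finset.coe_image] at this
    have hstep := hval.relfinrank_sup_adjoin_simple hϖ0 hϖ1 hd (le_sup_left (a := F) (hδF β hβ))
      (hself β hβ) hkd
    have ih' := ih (fun γ h => hδF γ (hsub h)) (fun γ h => hwπ γ (hsub h)) (fun γ h => hwd γ (hsub h))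
      (fun γ h => hwF γ (hsub h)) (fun γ h => hself γ (hsub h))
      (fun γ h γ' h' => hne γ (hsub h) γ' (hsub h'))
    rw [Finset.coe_insert, Set.image_insert_eq, Set.insert_eq, Set.union_comm,
      IntermediateField.adjoin_union, ← sup_assoc,
      ← IntermediateField.relfinrank_mul_relfinrank (B := F ⊔ IntermediateField.adjoin K (δ '' T))
        le_sup_left le_sup_left, ih', hstep, Finset.card_insert_of_notMem hβT, pow_succ]

end Tower

/-! ### Roots of integral polynomials -/

section Integral

variable {E Γ : Type*} [Field E] [LinearOrderedCommGroupWithZero Γ] {w : Valuation E Γ}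

theorem Valuation.eval_le_one {f : E[X]} (hf : ∀ n, w (f.coeff n) ≤ 1) {x : E} (hx : w x ≤ 1) :
    w (f.eval x) ≤ 1 := by
  rw [eval_eq_sum_range]
  refine w.map_sum_le fun n _ => ?_
  rw [map_mul, map_pow]
  exact mul_le_one' (hf n) (pow_le_one' hx n)

theorem Valuation.le_one_of_eval_eq_zero {f : E[X]} (hm : f.Monic) (hf : ∀ n, w (f.coeff n) ≤ 1)
    {x : E} (hx : f.eval x = 0) : w x ≤ 1 := by
  obtain ⟨g, rfl⟩ : ∃ g : w.integer[X], g.map w.integer.subtype = f :=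
    (mem_lifts f).1 ((lifts_iff_coeff_lifts f).2 fun n => ⟨⟨_, hf n⟩, rfl⟩)
  refine (Valuation.integer.integers w).mem_of_integral
    ⟨g, monic_of_injective Subtype.val_injective hm, ?_⟩
  rwa [eval_map] at hx

theorem Valuation.eq_one_of_eval_eq_zero {f : E[X]} (hm : f.Monic) (hf : ∀ n, w (f.coeff n) ≤ 1)
    (h0 : w (f.eval 0) = 1) {x : E} (hx : f.eval x = 0) : w x = 1 := by
  have hx1 := Valuation.le_one_of_eval_eq_zero hm hf hx
  refine hx1.antisymm (h0.symm.trans_le ?_)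
  have h1 : f.eval 0 = -(f.divX.eval x * x) := by
    have h2 := congrArg (eval x) f.divX_mul_X_add
    rw [eval_add, eval_mul, eval_X, eval_C, hx, coeff_zero_eq_eval_zero] at h2
    exact eq_neg_of_add_eq_zero_right h2
  rw [h1, Valuation.map_neg, map_mul]
  refine mul_le_of_le_one_left' (Valuation.eval_le_one (fun n => ?_) hx1)
  rw [coeff_divX]
  exact hf _

/-- A monic integral polynomial has at most one root in each residue class of a root at which its
derivative is a unit. -/
theorem Valuation.sub_eq_one_of_roots {f : E[X]} (hm : f.Monic) (hf : ∀ n, w (f.coeff n) ≤ 1)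
    {x y : E} (hx : f.eval x = 0) (hy : f.eval y = 0) (hxy : x ≠ y)
    (h1 : w (f.derivative.eval x) = 1) : w (x - y) = 1 := by
  have hx1 := Valuation.le_one_of_eval_eq_zero hm hf hx
  have hy1 := Valuation.le_one_of_eval_eq_zero hm hf hy
  obtain ⟨g, rfl⟩ : ∃ g : w.integer[X], g.map w.integer.subtype = f :=
    (mem_lifts f).1 ((lifts_iff_coeff_lifts f).2 fun n => ⟨⟨_, hf n⟩, rfl⟩)
  let x' : w.integer := ⟨x, hx1⟩
  let y' : w.integer := ⟨y, hy1⟩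
  -- Taylor expansion at `x`: `0 = f(y) = f'(x)(y - x) + k(y - x)²`
  obtain ⟨k, hk⟩ := (g.binomExpansion x' (y' - x'))
  have hgx : g.eval x' = 0 := Subtype.ext (by
    rw [← w.integer.subtype_apply, ← eval₂_at_apply]
    rwa [eval_map] at hx)
  have hgy : g.eval y' = 0 := Subtype.ext (by
    rw [← w.integer.subtype_apply, ← eval₂_at_apply]
    rwa [eval_map] at hy)
  rw [add_sub_cancel, hgx, hgy, zero_add] at hk
  have hne : y' - x' ≠ 0 := fun h => hxy (congrArg Subtype.val (sub_eq_zero.1 h)).symm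
  have h2 : g.derivative.eval x' = (x' - y') * k := by
    apply mul_right_cancel₀ hne
    linear_combination -hk
  have h3 : eval x (derivative (g.map w.integer.subtype)) = (x - y) * (k : E) := by
    rw [derivative_map, eval_map, show x = w.integer.subtype x' from rfl, eval₂_at_apply, h2]
    rfl
  have h4 : w (x - y) ≤ 1 := (w.map_sub_le hx1 hy1)
  rw [h3, map_mul] at h1
  exact h4.antisymm (h1 ▸ mul_le_of_le_one_right' k.2)

theorem Valuation.sub_eq_one_of_root_sub_lt_one {f : E[X]} (hm : f.Monic)
    (hf : ∀ n, w (f.coeff n) ≤ 1) {x y a : E} (hx : f.eval x = 0) (hy : f.eval y = 0)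
    (hyx : y ≠ x) (h1 : w (f.derivative.eval x) = 1) (hlt : w (x - a) < 1) : w (y - a) = 1 := by
  have h2 := Valuation.sub_eq_one_of_roots hm hf hx hy hyx.symm h1
  rw [← h2, ← w.map_sub_eq_of_lt_left (hlt.trans_eq h2.symm), ← w.map_neg]
  congr 1
  ring

/-- If `f` is separable modulo the maximal ideal and `f(a)` is not a unit, then exactly one root of
`f` is congruent to `a`, and its distance to `a` accounts for the whole value of
`f(a) = ∏ (a - β)`. -/
theorem Valuation.exists_root_sub_eq [IsAlgClosed E] {f : E[X]} (hm : f.Monic)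
    (hf : ∀ n, w (f.coeff n) ≤ 1) (hnodup : f.roots.Nodup)
    (hder : ∀ x, f.eval x = 0 → w (f.derivative.eval x) = 1) {a : E} (ha : w a ≤ 1)
    (hlt : w (f.eval a) < 1) : ∃ β, f.eval β = 0 ∧ w (β - a) = w (f.eval a) := by
  classical
  have hmem {β : E} : β ∈ f.roots.toFinset ↔ f.eval β = 0 := by
    rw [Multiset.mem_toFinset, mem_roots hm.ne_zero, IsRoot.def]
  have hprod : w (f.eval a) = ∏ β ∈ f.roots.toFinset, w (β - a) := by
    rw [(IsAlgClosed.splits f).eval_eq_prod_roots_of_monic hm, map_multiset_prod,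
      Multiset.map_map, Finset.prod, Multiset.toFinset_val, hnodup.dedup]
    congr 1
    exact Multiset.map_congr rfl fun β _ => w.map_sub_swap a β
  obtain ⟨β, hβ, hβ1⟩ : ∃ β, f.eval β = 0 ∧ w (β - a) < 1 := by
    by_contra! hcon
    refine hlt.ne (hprod.trans (Finset.prod_eq_one fun β hβ => ?_))
    have hβ := hmem.1 hβ
    exact (w.map_sub_le (Valuation.le_one_of_eval_eq_zero hm hf hβ) ha).antisymm (hcon β hβ)
  refine ⟨β, hβ, ?_⟩
  rw [hprod, Finset.prod_eq_single β]
  · exact fun γ hγ hne => Valuation.sub_eq_one_of_root_sub_lt_one hm hf hβ (hmem.1 hγ) hne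
      (hder β hβ) hβ1
  · exact fun h => absurd (hmem.2 hβ) h

end Integral

/-! ### Compositions of unicritical polynomials -/

section SeqComp

variable {K : Type*} [Field K] {d s : ℕ} {c : Fin s → K} {θ : ℕ → K[X]}

theorem seqComp_monic (hd : d ≠ 0) (hθ : ∀ i, θ i ∈ unicriticalSet d c) (m : ℕ) :
    (seqComp θ m).Monic := by
  induction m with
  | zero => exact monic_X
  | succ m ih =>
    obtain ⟨i, hi⟩ := hθ m
    rw [seqComp, ← hi]
    exact ih.comp (monic_X_pow_add_C _ hd) (by simpa)

theorem natDegree_seqComp (hθ : ∀ i, θ i ∈ unicriticalSet d c) (m : ℕ) :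
    (seqComp θ m).natDegree = d ^ m := by
  induction m with
  | zero => simp [seqComp]
  | succ m ih =>
    obtain ⟨i, hi⟩ := hθ m
    rw [seqComp, natDegree_comp, ih, ← hi, natDegree_X_pow_add_C, pow_succ]

theorem coeff_seqComp_mem {O : Subring K} (hθ : ∀ i, θ i ∈ unicriticalSet d c)
    (hc : ∀ i, c i ∈ O) (m n : ℕ) : (seqComp θ m).coeff n ∈ O := by
  have h : seqComp θ m ∈ lifts O.subtype := by
    induction m with
    | zero => exact X_mem_lifts _
    | succ m ih =>
      obtain ⟨i, hi⟩ := hθ m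
      obtain ⟨g, hg⟩ := (mem_lifts _).1 ih
      refine (mem_lifts _).2 ⟨g.comp (X ^ d + C ⟨c i, hc i⟩), ?_⟩
      rw [map_comp, hg, seqComp, ← hi]
      simp
  obtain ⟨y, hy⟩ := (lifts_iff_coeff_lifts _).1 h n
  exact hy ▸ y.2

/-- By the chain rule, `γₘ'(x)` is the product of `d * y ^ (d - 1)` over `y = x`, `θₘ(x)`,
`θₘ₋₁(θₘ(x))`, …, `θ₂(⋯θₘ(x))`; each `y` is a root of some `γₗ` with `γₗ(0)` a unit, hence a unit. -/
theorem derivative_eval_root_seqComp {E Γ : Type*} [Field E] [Algebra K E]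
    [LinearOrderedCommGroupWithZero Γ] {w : Valuation E Γ} (hd : d ≠ 0)
    (hθ : ∀ i, θ i ∈ unicriticalSet d c) (hwd : w d = 1) (hc : ∀ i, w (algebraMap K E (c i)) ≤ 1)
    {m : ℕ} (hm : ∀ l, 1 ≤ l → l ≤ m → w (algebraMap K E ((seqComp θ l).eval 0)) = 1)
    {x : E} (hx : aeval x (seqComp θ m) = 0) : w (aeval x (seqComp θ m).derivative) = 1 := by
  induction m generalizing x with
  | zero => simp [seqComp]
  | succ m ih =>
    have hx1 : w x = 1 := by
      refine Valuation.eq_one_of_eval_eq_zero (f := (seqComp θ (m + 1)).map (algebraMap K E))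
        ((seqComp_monic hd hθ _).map _) (fun n => ?_) ?_ (by rwa [eval_map_algebraMap])
      · rw [coeff_map]
        exact coeff_seqComp_mem (O := (w.comap (algebraMap K E)).integer) hθ hc _ n
      · rw [← map_zero (algebraMap K E), eval_map_algebraMap, aeval_algebraMap_apply,
          coe_aeval_eq_eval]
        exact hm _ (by lia) le_rfl
    obtain ⟨i, hi⟩ := hθ m
    rw [seqComp, aeval_comp] at hx
    rw [seqComp, derivative_comp, map_mul, aeval_comp, map_mul,
      ih (fun l h1 h2 => hm l h1 (by lia)) hx, mul_one, ← hi]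
    rw [derivative_add, derivative_C, add_zero, derivative_X_pow]
    simp [hwd, hx1]

end SeqComp

theorem mem_rootSet_seqComp {K E : Type*} [Field K] [Field E] [Algebra K E] {d s : ℕ}
    {c : Fin s → K} {θ : ℕ → K[X]} (hd : d ≠ 0) (hθ : ∀ i, θ i ∈ unicriticalSet d c) {m : ℕ}
    {x : E} : x ∈ (seqComp θ m).rootSet E ↔ aeval x (seqComp θ m) = 0 := by
  rw [mem_rootSet]
  exact and_iff_right (seqComp_monic hd hθ m).ne_zero

/-- Over a field with the `d`-th roots of unity, the splitting field of `f(x ^ d + a)` is obtained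
from that of `f` by adjoining one `d`-th root of `β - a` for each root `β` of `f`. -/
theorem splittingFieldIn_seqComp_succ {K : Type*} [Field K] {d s : ℕ}
    {c : Fin s → K} {θ : ℕ → K[X]} (hd : d ≠ 0) (hθ : ∀ i, θ i ∈ unicriticalSet d c)
    (hζ : ∃ ζ : K, IsPrimitiveRoot ζ d) {m : ℕ} {a : K} (ha : θ m = X ^ d + C a)
    {δ : AlgebraicClosure K → AlgebraicClosure K}
    (hδ : ∀ β, δ β ^ d = β - algebraMap K _ a) :
    splittingFieldIn (seqComp θ (m + 1)) = splittingFieldIn (seqComp θ m) ⊔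
      IntermediateField.adjoin K (δ '' (seqComp θ m).rootSet (AlgebraicClosure K)) := by
  have hcomp (x : AlgebraicClosure K) : aeval x (seqComp θ (m + 1)) =
      aeval (x ^ d + algebraMap K _ a) (seqComp θ m) := by
    rw [seqComp, aeval_comp, ha]
    simp
  have hmem {β : AlgebraicClosure K} (hβ : β ∈ (seqComp θ m).rootSet (AlgebraicClosure K)) :
      δ β ∈ splittingFieldIn (seqComp θ (m + 1)) := by
    refine IntermediateField.subset_adjoin _ _ ((mem_rootSet_seqComp hd hθ).2 ?_)
    rw [hcomp, hδ, sub_add_cancel]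
    exact (mem_rootSet_seqComp hd hθ).1 hβ
  apply le_antisymm
  · refine IntermediateField.adjoin_le_iff.2 fun x hx => ?_
    rw [mem_rootSet_seqComp hd hθ, hcomp, ← mem_rootSet_seqComp hd hθ] at hx
    have hδx : δ (x ^ d + algebraMap K _ a) ∈ IntermediateField.adjoin K
        (δ '' (seqComp θ m).rootSet (AlgebraicClosure K)) :=
      IntermediateField.subset_adjoin _ _ ⟨_, hx, rfl⟩
    have hpow := hδ (x ^ d + algebraMap K _ a)
    rw [add_sub_cancel_right] at hpow
    refine le_sup_right (α := IntermediateField K (AlgebraicClosure K)) ?_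
    set y := δ (x ^ d + algebraMap K _ a)
    by_cases hy : y = 0
    · rw [hy, zero_pow hd] at hpow
      rw [eq_zero_of_pow_eq_zero hpow.symm]
      exact zero_mem _
    obtain ⟨ζ, hζ⟩ := hζ
    have : NeZero d := ⟨hd⟩
    obtain ⟨i, -, hi⟩ := (hζ.map_of_injective (algebraMap K (AlgebraicClosure K)).injective
      ).eq_pow_of_pow_eq_one (ξ := x / y)
      (by rw [div_pow, hpow, div_self (hpow ▸ pow_ne_zero d hy)])
    rw [← div_mul_cancel₀ x hy, ← hi, ← map_pow]
    exact mul_mem (IntermediateField.algebraMap_mem _ _) hδx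
  · refine sup_le (IntermediateField.adjoin_le_iff.2 fun β hβ => ?_)
      (IntermediateField.adjoin_le_iff.2 ?_)
    · rw [SetLike.mem_coe, ← sub_add_cancel β (algebraMap K _ a), ← hδ]
      exact add_mem (pow_mem (hmem hβ) d) (IntermediateField.algebraMap_mem _ _)
    · rintro _ ⟨β, hβ, rfl⟩
      exact hmem hβ

theorem irreducible_seqComp_of_succ {K : Type*} [Field K] {d s : ℕ}
    {c : Fin s → K} {θ : ℕ → K[X]} (hd : d ≠ 0) (hθ : ∀ i, θ i ∈ unicriticalSet d c) {m : ℕ}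
    (h : Irreducible (seqComp θ (m + 1))) : Irreducible (seqComp θ m) := by
  obtain ⟨i, hi⟩ := hθ m
  have hdeg : (θ m).natDegree ≠ 0 := by rwa [← hi, natDegree_X_pow_add_C]
  have hunit (p : K[X]) : IsUnit (p.comp (θ m)) ↔ IsUnit p := by
    by_cases hp : p = 0
    · simp [hp]
    have hp' : p.comp (θ m) ≠ 0 := fun h0 => by
      rcases comp_eq_zero_iff.1 h0 with h | ⟨-, h⟩
      · exact hp h
      · exact hdeg (by rw [h, natDegree_C])
    rw [isUnit_iff_degree_eq_zero, isUnit_iff_degree_eq_zero, degree_eq_natDegree hp,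
      degree_eq_natDegree hp', natDegree_comp]
    simp [hdeg]
  refine ⟨fun hu => h.not_isUnit ((hunit _).2 hu), fun p q hpq => ?_⟩
  rw [← hunit p, ← hunit q]
  exact h.isUnit_or_isUnit (by rw [seqComp, hpq, mul_comp])

/-! ### The degree of `K(γₙ)` over `K(γₙ₋₁)` -/

theorem mainTheorem9 {K : Type*} [Field K] [CharZero K]
    (d : ℕ) (hd : 2 ≤ d) (hζ : ∃ ζ : K, IsPrimitiveRoot ζ d)
    {s : ℕ} (c : Fin s → K)
    (θ : ℕ → K[X]) (hθ : ∀ i, θ i ∈ unicriticalSet d c)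
    (n : ℕ) (hn : 2 ≤ n) (hirr : Irreducible (seqComp θ n))
    (v : Valuation K ℤᵐ⁰) (hv : IsNumberFieldPrime K v ∨ IsFunctionFieldPrime K v)
    (hgood : IsGoodPrimitivePrimeDivisor v d c θ n) :
    splittingFieldIn (seqComp θ (n - 1)) ≤ splittingFieldIn (seqComp θ n) ∧
      IntermediateField.relfinrank (splittingFieldIn (seqComp θ (n - 1)))
        (splittingFieldIn (seqComp θ n)) = d ^ d ^ (n - 1) := by
  classical
  obtain ⟨m, rfl⟩ : ∃ m, n = m + 1 := ⟨n - 1, by lia⟩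
  rw [Nat.add_sub_cancel]
  have hd0 : d ≠ 0 := by lia
  obtain ⟨hvd, hvc, ⟨e, he, hed, hve⟩, hlow⟩ := hgood
  rw [Nat.add_sub_cancel] at hlow
  obtain ⟨i, hi⟩ := hθ m
  set a := c i
  let E := AlgebraicClosure K
  set f := seqComp θ m with hf
  have hfirr : Irreducible f := irreducible_seqComp_of_succ hd0 hθ hirr
  have hfm : f.Monic := seqComp_monic hd0 hθ m
  have hroot {x : E} : x ∈ f.rootSet E ↔ aeval x f = 0 := mem_rootSet_seqComp hd0 hθ
  choose δ hδ using fun β : E => IsAlgClosed.exists_pow_nat_eq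
    (β - algebraMap K E a) (by lia : 0 < d)
  rw [splittingFieldIn_seqComp_succ hd0 hθ hζ hi.symm hδ, ← hf]
  refine ⟨le_sup_left, ?_⟩
  -- a uniformizer `π` at `v`
  obtain ⟨π, g, hg, hπ, hgen⟩ := Valuation.exists_generator he hve
  have hvπ1 : v π < 1 := by
    rw [hπ, ← WithZero.exp_zero, WithZero.exp_lt_exp]
    lia
  have hπ0 : π ≠ 0 := v.ne_zero_iff.1 (by rw [hπ]; exact WithZero.exp_ne_zero)
  have htop0 : (seqComp θ (m + 1)).eval 0 ≠ 0 :=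
    v.ne_zero_iff.1 (by rw [hve]; exact WithZero.exp_ne_zero)
  obtain ⟨k, hk⟩ := hgen _ htop0
  have hkd : IsCoprime k d := by
    have h1 : (e : ℤ) = k * g := by
      have h2 := hk
      rw [hve, hπ, ← WithZero.exp_zsmul, WithZero.exp_inj, smul_eq_mul] at h2
      linear_combination -h2
    have h3 : IsCoprime (e : ℤ) d := Nat.isCoprime_iff_coprime.2 hed
    rw [h1] at h3
    exact h3.of_mul_left_left
  obtain ⟨B, hB⟩ := Valuation.exists_isEquiv_comap_algebraMap (E := E) v
  set w₀ := B.valuation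
  set ϖ := w₀ (algebraMap K E π)
  have hϖ1 : ϖ < 1 := hB.lt_one_iff_lt_one.1 hvπ1
  -- facts about an arbitrary extension `w` of `v` with the same value of `π`
  have hvals (w : Valuation E B.ValueGroup) (hw : v.IsEquiv (w.comap (algebraMap K E)))
      (hwπ : w (algebraMap K E π) = ϖ) (x : K) (l : ℤ) (hl : v x = v π ^ l) :
      w (algebraMap K E x) = ϖ ^ l := by
    have := hw.eq_iff (r := x) (s := π ^ l)
    simp only [map_zpow₀, Valuation.comap_apply, hwπ] at this
    exact this.1 hl
  have hcoeff (w : Valuation E B.ValueGroup) (hw : v.IsEquiv (w.comap (algebraMap K E))) (j : ℕ) :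
      w ((f.map (algebraMap K E)).coeff j) ≤ 1 := by
    rw [coeff_map]
    exact hw.le_one_iff_le_one.1 (coeff_seqComp_mem (O := v.integer) hθ hvc m j)
  have hwd (w : Valuation E B.ValueGroup) (hw : v.IsEquiv (w.comap (algebraMap K E))) :
      w d = 1 := by
    simpa using hw.eq_one_iff_eq_one.1 hvd
  have hder (w : Valuation E B.ValueGroup) (hw : v.IsEquiv (w.comap (algebraMap K E)))
      (x : E) (hx : aeval x f = 0) : w (aeval x f.derivative) = 1 :=
    derivative_eval_root_seqComp hd0 hθ (hwd w hw) (fun j => hw.le_one_iff_le_one.1 (hvc j))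
      (fun l h1 h2 => hw.eq_one_iff_eq_one.1 (hlow l h1 h2)) hx
  have hunram (w : Valuation E B.ValueGroup) (hw : v.IsEquiv (w.comap (algebraMap K E)))
      (hwπ : w (algebraMap K E π) = ϖ) : w.ValuesInZPowers ϖ (splittingFieldIn f) := by
    rw [← hwπ]
    refine Valuation.valuesInZPowers_adjoin_rootSet hπ0 (by rwa [hwπ]) (fun x hx => ?_) hfm
      (fun j => ?_) (hder w hw)
    · obtain ⟨l, hl⟩ := hgen x hx
      exact ⟨l, by rw [hwπ, hvals w hw hwπ x l hl]⟩
    · simpa using hcoeff w hw j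
  have htop := hvals w₀ hB rfl _ k hk
  have hkpos : ϖ ^ k < 1 := by
    rw [← htop]
    refine hB.lt_one_iff_lt_one.1 ?_
    rw [hve, ← WithZero.exp_zero, WithZero.exp_lt_exp]
    lia
  have heval : (f.map (algebraMap K E)).eval (algebraMap K E a) =
      algebraMap K E ((seqComp θ (m + 1)).eval 0) := by
    rw [eval_map_algebraMap, aeval_algebraMap_apply, coe_aeval_eq_eval, seqComp, eval_comp, ← hi]
    simp [hd0, a, hf]
  obtain ⟨β₀, hβ₀, hβ₀1⟩ := Valuation.exists_root_sub_eq (hfm.map (algebraMap K E)) (hcoeff w₀ hB)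
    (nodup_roots hfirr.separable.map)
    (fun x hx => by
      rw [derivative_map, eval_map_algebraMap]
      exact hder w₀ hB x (by rwa [eval_map_algebraMap] at hx))
    (a := algebraMap K E a) (hB.le_one_iff_le_one.1 (hvc i)) (by rwa [heval, htop])
  rw [eval_map_algebraMap] at hβ₀
  rw [heval, htop] at hβ₀1
  -- by transitivity of the Galois group on the roots, `β₀` can be moved to any root
  have hconj (β : E) : ∃ σ : E ≃ₐ[K] E, aeval β f = 0 → σ β = β₀ := by
    by_cases hβ : aeval β f = 0
    · have hmin : minpoly K β = f := (minpoly.eq_of_irreducible_of_monic hfirr hβ hfm).symm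
      obtain ⟨σ, hσ⟩ := minpoly.exists_algEquiv_of_root' (K := K) (x := β₀) (y := β)
        (Algebra.IsAlgebraic.isAlgebraic β) (by rwa [hmin])
      exact ⟨σ, fun _ => hσ⟩
    · exact ⟨AlgEquiv.refl, fun h => absurd h hβ⟩
  choose σ hσ using hconj
  let w (β : E) : Valuation E B.ValueGroup := w₀.comap (σ β : E →+* E)
  have hwK (β : E) (x : K) : w β (algebraMap K E x) = w₀ (algebraMap K E x) :=
    congrArg w₀ ((σ β).commutes x)
  have hw (β : E) : v.IsEquiv ((w β).comap (algebraMap K E)) := by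
    have : (w β).comap (algebraMap K E) = w₀.comap (algebraMap K E) := Valuation.ext (hwK β)
    rwa [this]
  have hwself (β : E) (hβ : aeval β f = 0) : w β (β - algebraMap K E a) = ϖ ^ k := by
    rw [← hβ₀1, ← hσ β hβ]
    change w₀ (σ β (β - algebraMap K E a)) = _
    rw [map_sub, (σ β).commutes]
  have hcard : (f.rootSet E).toFinset.card = d ^ m := by
    rw [Set.toFinset_card, card_rootSet_eq_natDegree hfirr.separable (IsAlgClosed.splits _), hf,
      natDegree_seqComp hθ]
  have hT {β : E} (hβ : β ∈ (f.rootSet E).toFinset) : aeval β f = 0 :=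
    hroot.1 (Set.mem_toFinset.1 hβ)
  have key := relfinrank_sup_adjoin_image_eq_pow (F := splittingFieldIn f) hπ0 hϖ1
    (d := d) (by lia) (f.rootSet E).toFinset δ
    (fun β hβ => by
      rw [hδ]
      exact sub_mem (IntermediateField.subset_adjoin _ _ (Set.mem_toFinset.1 hβ))
        (IntermediateField.algebraMap_mem _ _))
    w (fun β _ => hwK β π) (fun β _ => hwd _ (hw β))
    (fun β _ => hunram _ (hw β) (hwK β π)) hkd
    (fun β hβ => by rw [hδ, hwself β (hT hβ)])
    (fun β hβ β' hβ' hne => by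
      rw [hδ]
      refine Valuation.sub_eq_one_of_root_sub_lt_one (hfm.map (algebraMap K E)) (hcoeff _ (hw β))
        (x := β) ?_ ?_ hne ?_ ((hwself β (hT hβ)).trans_lt hkpos)
      · rw [eval_map_algebraMap, hT hβ]
      · rw [eval_map_algebraMap, hT hβ']
      · rw [derivative_map, eval_map_algebraMap, hder _ (hw β) β (hT hβ)])
  rwa [hcard, Set.coe_toFinset] at key
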